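/- Let $I=[0,1]$ and let $PL_o(I)$ be the group of orientation-preserving piecewise linear homeomorphisms of $I$ with finitely many breakpoints. An orbital of $f\in PL_o(I)$ is a maximal interval contained in the support $\{x\in I : f(x)\neq x\}$ of $f$. A subgroup $G\le PL_o(I)$ has no transition chains if, whenever $f,g\in G$, $A$ is an orbital of $f$, $B$ is an orbital of $g$ and $A\cap B\neq\emptyset$, one has $A\subseteq B$ or $B\subseteq A$. Theorem. Every subgroup $G\le PL_o(I)$ with no transition chains is countable (finite or countably infinite). -/

import Mathlib

open Topology unitInterval

namespace PLHomeo

/-- `f` agrees with an affine function `y ↦ m * y + c` near the point `x` of the unit interval. -/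
def AffineNear (f : I ≃ₜ I) (x : I) : Prop :=
  ∃ m c : ℝ, ∀ᶠ y : I in 𝓝 x, (f y : ℝ) = m * (y : ℝ) + c

/-- The breakpoints of `f`: the points near which `f` is not affine. -/
def breakpoints (f : I ≃ₜ I) : Set I := {x | ¬ AffineNear f x}

theorem breakpoints_one : breakpoints 1 = ∅ := by
  ext x
  simp only [breakpoints, Set.mem_ofPred_eq, Set.mem_empty_iff_false, iff_false, not_not]
  exact ⟨1, 0, Filter.Eventually.of_forall fun y => by simp⟩

theorem breakpoints_mul (f g : I ≃ₜ I) :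
    breakpoints (f * g) ⊆ breakpoints g ∪ g ⁻¹' breakpoints f := by
  intro x hx
  by_contra h
  simp only [breakpoints, Set.mem_union, Set.mem_preimage, Set.mem_ofPred_eq, not_or,
    not_not] at h
  obtain ⟨⟨m, c, hg⟩, ⟨m', c', hf⟩⟩ := h
  refine hx ⟨m' * m, m' * c + c', ?_⟩
  filter_upwards [hg, g.continuous.continuousAt.eventually hf] with y h1 h2
  change ((f (g y) : I) : ℝ) = _
  rw [h2, h1]
  ring

theorem breakpoints_inv (f : I ≃ₜ I) : breakpoints f⁻¹ ⊆ f '' breakpoints f := by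
  intro x hx
  refine ⟨f.symm x, ?_, f.apply_symm_apply x⟩
  rintro ⟨m, c, h⟩
  have h' : ∀ᶠ y : I in 𝓝 x, (y : ℝ) = m * (f.symm y : ℝ) + c := by
    filter_upwards [f.symm.continuous.continuousAt.eventually h] with y hy
    simpa using hy
  have hm : m ≠ 0 := by
    rintro rfl
    have h2 : ∀ᶠ y in 𝓝 x, y = x := by
      have hx0 := h'.self_of_nhds
      filter_upwards [h'] with y hy
      apply Subtype.ext
      rw [hy, hx0]
      simp
    have h3 : ∃ᶠ y in 𝓝 x, y ≠ x :=
      (Filter.Eventually.frequently (f := 𝓝[≠] x) self_mem_nhdsWithin).filter_mono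
        nhdsWithin_le_nhds
    exact h3 (h2.mono fun y hy => not_not.mpr hy)
  refine hx ⟨m⁻¹, -(m⁻¹ * c), ?_⟩
  filter_upwards [h'] with y hy
  change ((f.symm y : I) : ℝ) = _
  rw [hy]
  field_simp
  simp

/-- The group of orientation-preserving piecewise linear homeomorphisms of the unit interval
with finitely many breakpoints. -/
def PLo : Subgroup (I ≃ₜ I) where
  carrier := {f | StrictMono f ∧ (breakpoints f).Finite}
  one_mem' := ⟨strictMono_id, by rw [breakpoints_one]; exact Set.finite_empty⟩
  mul_mem' := by
    rintro f g ⟨hf, hf'⟩ ⟨hg, hg'⟩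
    exact ⟨hf.comp hg,
      (hg'.union (hf'.preimage g.injective.injOn)).subset (breakpoints_mul f g)⟩
  inv_mem' := by
    rintro f ⟨hf, hf'⟩
    refine ⟨fun x y hxy => ?_, (hf'.image f).subset (breakpoints_inv f)⟩
    change f.symm x < f.symm y
    rw [← hf.lt_iff_lt]
    simpa using hxy

/-- The support of `f`: the points that `f` moves. -/
def supp (f : PLo) : Set I := {x | f.1 x ≠ x}

/-- `A` is an orbital of `f`: a maximal (nonempty) interval contained in the support of `f`. -/
def IsOrbital (f : PLo) (A : Set I) : Prop :=
  Maximal (fun J : Set I => J.Nonempty ∧ J.OrdConnected ∧ J ⊆ supp f) A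

/-- The signed orbitals of a set `C` of elements: the pairs `(A, f)` with `f ∈ C` and `A` an
orbital of `f`. -/
def signedOrbitals (C : Set PLo) : Set (Set I × PLo) :=
  {p | p.2 ∈ C ∧ IsOrbital p.2 p.1}

/-- Two signed orbitals form a transition chain if their orbitals meet and neither orbital is
contained in the other. -/
def IsTransitionChain (p q : Set I × PLo) : Prop :=
  (p.1 ∩ q.1).Nonempty ∧ ¬ p.1 ⊆ q.1 ∧ ¬ q.1 ⊆ p.1

/-- No pair of signed orbitals of `G` is a transition chain. -/
def NoTransitionChains (G : Subgroup PLo) : Prop :=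
  ∀ p ∈ signedOrbitals (G : Set PLo), ∀ q ∈ signedOrbitals (G : Set PLo),
    ¬ IsTransitionChain p q

end PLHomeo

/-!
Up to replacing an element by its inverse, an orbital is a *bump*: an open interval `(a, b)` with
fixed ends inside which every point moves to the right (`IsBump`). Absence of transition chains says
that bumps of elements of `G` never overlap like `a < c < b < d` (`NoOverlap`). This has three
consequences.

* Two bumps with a common end coincide (`NoOverlap.right_eq`, `NoOverlap.left_eq`). Otherwise a
  product of one element with a high inverse power of the other has a bump that overlaps the smaller
  of the two.
* If `f` has bump `(a, b)` and `(c, d)` is a bump strictly inside it, then `d ≤ f c`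
  (`NoOverlap.le_apply`), as otherwise `(c, d)` overlaps `(f c, f d)`. Hence among the nested bumps
  around a given point there are gaps, and `G` has only countably many bumps
  (`NoOverlap.countable_bumps`).
* For each bump `(a, b)` there are `c < d` in it such that `d ≤ h c` for every `h` in `G` with bump
  `(a, b)` (`NoOverlap.exists_le_apply`). If there is a smaller bump inside, its ends will do.
  Otherwise the elements with bump `(a, b)` commute there, and piecewise linearity prevents them from
  moving points too little (`exists_le_apply_of_no_smaller_bump`). Consequently elements of `G` with
  the same value but different slopes at a point map `(c, d)` to disjoint intervals, and there are
  only countably many such slopes (`NoOverlap.countable_rightSlopes`).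

An element is now read from left to right (`NoOverlap.countable_of_eqOn`). Given its restriction to
`[0, t]`, there are countably many possibilities for the slope at `t`. Given also the slope, if `x`
and `x'` are possible next breakpoints and `x < x'`, then the two corresponding elements separate
exactly at `x`, so that `x` is the left end of a bump; hence there are countably many possibilities
for the next breakpoint. As an element has finitely many breakpoints, `G` is countable.
-/

namespace PLHomeo

/-! ### Fixed points and bumps -/

theorem mul_apply (f g : PLo) (x : I) : (f * g).1 x = f.1 (g.1 x) := rfl

theorem inv_apply_self (f : PLo) (x : I) : f⁻¹.1 (f.1 x) = x := f.1.symm_apply_apply x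

theorem apply_inv_self (f : PLo) (x : I) : f.1 (f⁻¹.1 x) = x := f.1.apply_symm_apply x

theorem lt_iff (f : PLo) {x y : I} : f.1 x < f.1 y ↔ x < y := f.2.1.lt_iff_lt

theorem le_iff (f : PLo) {x y : I} : f.1 x ≤ f.1 y ↔ x ≤ y := f.2.1.le_iff_le

theorem inv_lt_iff (f : PLo) {x y : I} : f⁻¹.1 x < y ↔ x < f.1 y := by
  rw [← lt_iff f, apply_inv_self]

theorem lt_inv_iff (f : PLo) {x y : I} : x < f⁻¹.1 y ↔ f.1 x < y := by
  rw [← lt_iff f, apply_inv_self]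

theorem inv_fixed {f : PLo} {x : I} (h : f.1 x = x) : f⁻¹.1 x = x := by
  nth_rewrite 1 [← h]
  exact inv_apply_self f x

theorem cont (f : PLo) : Continuous f.1 := f.1.continuous

theorem apply_zero (f : PLo) : f.1 0 = 0 := by
  refine le_antisymm ?_ (f.1 0).2.1
  rw [← not_lt, ← inv_lt_iff, not_lt]
  exact (f⁻¹.1 0).2.1

theorem apply_one (f : PLo) : f.1 1 = 1 := by
  refine le_antisymm (f.1 1).2.2 ?_
  rw [← not_lt, ← lt_inv_iff, not_lt]
  exact (f⁻¹.1 1).2.2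

/-- `f` fixes `a < b` and moves every point strictly between them to the right. Every orbital of
`f` is such an interval for `f` or for `f⁻¹`. -/
def IsBump (f : PLo) (a b : I) : Prop :=
  a < b ∧ f.1 a = a ∧ f.1 b = b ∧ ∀ x ∈ Set.Ioo a b, x < f.1 x

theorem IsBump.isOrbital {f : PLo} {a b : I} (h : IsBump f a b) :
    IsOrbital f (Set.Ioo a b) := by
  obtain ⟨hab, ha, hb, hx⟩ := h
  obtain ⟨m, hm⟩ := Set.nonempty_Ioo.2 hab
  refine ⟨⟨⟨m, hm⟩, Set.ordConnected_Ioo, fun x h => (hx x h).ne'⟩, ?_⟩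
  rintro J ⟨-, hJ, hJs⟩ hsub x hxJ
  constructor
  · by_contra! hle
    exact hJs (hJ.out hxJ (hsub hm) ⟨hle, hm.1.le⟩) ha
  · by_contra! hle
    exact hJs (hJ.out (hsub hm) hxJ ⟨hm.2.le, hle⟩) hb

theorem IsBump.le_or_le {f : PLo} {a b z : I} (h : IsBump f a b) (hz : f.1 z = z) :
    z ≤ a ∨ b ≤ z := by
  by_contra! hc
  exact (h.2.2.2 z hc).ne' hz

theorem exists_fixed (f : PLo) {x y : I} (hx : x ≤ f.1 x) (hy : f.1 y ≤ y) :
    ∃ z ∈ Set.uIcc x y, f.1 z = z := by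
  obtain ⟨z, hz, h⟩ := (isPreconnected_uIcc (a := x) (b := y)).intermediate_value₂
    Set.left_mem_uIcc Set.right_mem_uIcc continuousOn_id (cont f).continuousOn hx hy
  exact ⟨z, hz, h.symm⟩

theorem exists_isBump_of_lt (f : PLo) {x : I} (hx : x < f.1 x) :
    ∃ a b, IsBump f a b ∧ a < x ∧ x < b := by
  have hK : IsClosed {y : I | f.1 y = y} := isClosed_eq (cont f) continuous_id
  obtain ⟨a, ⟨ha, hax⟩, hamax⟩ := (hK.inter (isClosed_Iic (a := x))).isCompact.exists_isGreatest
    ⟨0, apply_zero f, x.2.1⟩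
  obtain ⟨b, ⟨hb, hbx⟩, hbmin⟩ := (hK.inter (isClosed_Ici (a := x))).isCompact.exists_isLeast
    ⟨1, apply_one f, x.2.2⟩
  have hax' : a < x := lt_of_le_of_ne hax fun h => hx.ne' (h ▸ ha)
  have hbx' : x < b := lt_of_le_of_ne hbx fun h => hx.ne' (h.symm ▸ hb)
  refine ⟨a, b, ⟨hax'.trans hbx', ha, hb, fun y hy => ?_⟩, hax', hbx'⟩
  by_contra! hle
  obtain ⟨z, hz, hfz⟩ := exists_fixed f hx.le hle
  rcases le_total z x with h | h
  · have h1 : z ≤ a := hamax ⟨hfz, h⟩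
    exact absurd ((lt_min hax' hy.1).trans_le hz.1) h1.not_gt
  · have h1 : b ≤ z := hbmin ⟨hfz, h⟩
    exact absurd (hz.2.trans_lt (max_lt hbx' hy.2)) h1.not_gt

theorem exists_isBump {G : Subgroup PLo} {f : PLo} (hf : f ∈ G) {x : I} (hx : f.1 x ≠ x) :
    ∃ g ∈ G, ∃ a b, IsBump g a b ∧ a < x ∧ x < b ∧ ∀ y, f.1 y = y → g.1 y = y := by
  rcases hx.lt_or_gt with h | h
  · obtain ⟨a, b, h1, h2, h3⟩ := exists_isBump_of_lt f⁻¹ ((lt_inv_iff f).2 h)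
    exact ⟨f⁻¹, G.inv_mem hf, a, b, h1, h2, h3, fun y => inv_fixed⟩
  · obtain ⟨a, b, h1, h2, h3⟩ := exists_isBump_of_lt f h
    exact ⟨f, hf, a, b, h1, h2, h3, fun y => id⟩

theorem IsBump.apply_mem {f : PLo} {a b x : I} (h : IsBump f a b) (hx : x ∈ Set.Ioo a b) :
    f.1 x ∈ Set.Ioo a b :=
  ⟨hx.1.trans (h.2.2.2 x hx), h.2.2.1 ▸ (lt_iff f).2 hx.2⟩

theorem IsBump.inv_apply_mem {f : PLo} {a b x : I} (h : IsBump f a b) (hx : x ∈ Set.Ioo a b) :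
    f⁻¹.1 x ∈ Set.Ioo a b :=
  ⟨(lt_inv_iff f).2 (h.2.1.symm ▸ hx.1), (inv_lt_iff f).2 (h.2.2.1.symm ▸ hx.2)⟩

theorem pow_apply (f : PLo) (n : ℕ) (x : I) : (f ^ n).1 x = f.1^[n] x := by
  induction n generalizing x with
  | zero => rfl
  | succ n ih => rw [pow_succ, mul_apply, ih, Function.iterate_succ_apply]

theorem IsBump.pow_apply_mem {f : PLo} {a b x : I} (h : IsBump f a b) (hx : x ∈ Set.Ioo a b)
    (n : ℕ) : (f ^ n).1 x ∈ Set.Ioo a b := by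
  induction n with
  | zero => exact hx
  | succ n ih =>
    rw [pow_succ', mul_apply]
    exact h.apply_mem ih

theorem IsBump.monotone_pow_apply {f : PLo} {a b x : I} (h : IsBump f a b)
    (hx : x ∈ Set.Ioo a b) : Monotone fun n : ℕ => (f ^ n).1 x := by
  refine monotone_nat_of_le_succ fun n => ?_
  rw [pow_succ', mul_apply]
  exact (h.2.2.2 _ (h.pow_apply_mem hx n)).le

theorem IsBump.exists_lt_pow_apply {f : PLo} {a b x y : I} (h : IsBump f a b)
    (hx : x ∈ Set.Ioo a b) (hy : y < b) : ∃ n : ℕ, y < (f ^ n).1 x := by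
  by_contra! hle
  have hmono := h.monotone_pow_apply hx
  -- Otherwise the iterates converge to a fixed point of `f` between `x` and `y`.
  have hlim := tendsto_atTop_ciSup hmono ⟨y, by rintro _ ⟨n, rfl⟩; exact hle n⟩
  have hfix : f.1 (⨆ n : ℕ, (f ^ n).1 x) = ⨆ n : ℕ, (f ^ n).1 x := by
    simp only [pow_apply] at hlim ⊢
    exact isFixedPt_of_tendsto_iterate hlim (cont f).continuousAt
  have h1 := ge_of_tendsto' hlim fun n => hmono n.zero_le
  have h2 := le_of_tendsto' hlim hle
  rcases h.le_or_le hfix with h3 | h3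
  · exact absurd (hx.1.trans_le h1) h3.not_gt
  · exact absurd (h2.trans_lt hy) h3.not_gt

theorem IsBump.conj {f : PLo} {a b : I} (h : IsBump f a b) (g : PLo) :
    IsBump (g * f * g⁻¹) (g.1 a) (g.1 b) := by
  refine ⟨(lt_iff g).2 h.1, ?_, ?_, fun x hx => ?_⟩
  · rw [mul_apply, mul_apply, inv_apply_self, h.2.1]
  · rw [mul_apply, mul_apply, inv_apply_self, h.2.2.1]
  · rw [mul_apply, mul_apply, ← inv_lt_iff]
    exact h.2.2.2 _ ⟨(lt_inv_iff g).2 hx.1, (inv_lt_iff g).2 hx.2⟩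

/-! ### Bumps of a group without transition chains -/

/-- Bumps of elements of `G` never overlap like `a < c < b < d`: the form in which the absence of
transition chains is used. -/
def NoOverlap (G : Subgroup PLo) : Prop :=
  ∀ ⦃f g : PLo⦄, f ∈ G → g ∈ G → ∀ ⦃a b c d : I⦄, IsBump f a b → IsBump g c d →
    a < c → c < b → ¬ b < d

theorem NoTransitionChains.noOverlap {G : Subgroup PLo} (hG : NoTransitionChains G) :
    NoOverlap G := by
  intro f g hf hg a b c d hab hcd hac hcb hbd
  refine hG (Set.Ioo a b, f) ⟨hf, hab.isOrbital⟩ (Set.Ioo c d, g) ⟨hg, hcd.isOrbital⟩ ⟨?_, ?_, ?_⟩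
  · obtain ⟨x, hx⟩ := exists_between hcb
    exact ⟨x, ⟨hac.trans hx.1, hx.2⟩, hx.1, hx.2.trans hbd⟩
  · intro h
    obtain ⟨x, hx⟩ := exists_between hac
    exact absurd (h ⟨hx.1, hx.2.trans hcb⟩).1 hx.2.not_gt
  · intro h
    exact absurd (h ⟨hcb, hbd⟩).2 (lt_irrefl b)

variable {G : Subgroup PLo}

/-- If `d < b`, then `f⁻¹ * k ^ m` for large `m` moves `d` and fixes a point of `(c, d)`, so that
its bump around `d` overlaps `(c, d)`. -/
theorem NoOverlap.not_lt_right (hG : NoOverlap G) {f k : PLo} (hf : f ∈ G) (hk : k ∈ G)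
    {b c d : I} (h1 : IsBump k c d) (h2 : IsBump f c b) : ¬ d < b := by
  intro hdb
  have hd : d ∈ Set.Ioo c b := ⟨h1.1, hdb⟩
  obtain ⟨y, hcy, hyd⟩ := exists_between (h2.inv_apply_mem hd).1
  have hfy : f.1 y < d := (lt_inv_iff f).1 hyd
  have hy : y ∈ Set.Ioo c d :=
    ⟨hcy, (h2.2.2.2 y ⟨hcy, hyd.trans (h2.inv_apply_mem hd).2⟩).trans hfy⟩
  obtain ⟨m, hm⟩ := h1.exists_lt_pow_apply hy hfy
  -- `f⁻¹ * k ^ m` moves `d` to the left but `y` to the right.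
  have hpG : f⁻¹ * k ^ m ∈ G := G.mul_mem (G.inv_mem hf) (G.pow_mem hk m)
  have hkd : (k ^ m).1 d = d := by
    rw [pow_apply]
    exact Function.IsFixedPt.iterate h1.2.2.1 m
  have hpd : (f⁻¹ * k ^ m).1 d < d := by
    rw [mul_apply, hkd, inv_lt_iff]
    exact h2.2.2.2 d hd
  have hpy : y < (f⁻¹ * k ^ m).1 y := by
    rw [mul_apply, lt_inv_iff]
    exact hm
  obtain ⟨z, hz, hpz⟩ := exists_fixed _ hpy.le hpd.le
  rw [Set.uIcc_of_le hy.2.le] at hz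
  have hzd : z < d := lt_of_le_of_ne hz.2 fun h => hpd.ne (h ▸ hpz)
  obtain ⟨q, hq, a', b', hb, ha', hb', hfix⟩ := exists_isBump hpG hpd.ne
  have hza : z ≤ a' := (hb.le_or_le (hfix z hpz)).resolve_right (hzd.trans hb').not_ge
  exact hG hk hq h1 hb (hcy.trans_le (hz.1.trans hza)) ha' hb'

/-- The mirror image of `NoOverlap.not_lt_right`. -/
theorem NoOverlap.not_lt_left (hG : NoOverlap G) {f k : PLo} (hf : f ∈ G) (hk : k ∈ G)
    {a b c : I} (h1 : IsBump k c b) (h2 : IsBump f a b) : ¬ a < c := by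
  intro hac
  have hc : c ∈ Set.Ioo a b := ⟨hac, h1.1⟩
  have hcf := h2.2.2.2 c hc
  obtain ⟨y, hcy, hyb⟩ := exists_between (h2.apply_mem hc).2
  have hy : y ∈ Set.Ioo c b := ⟨hcf.trans hcy, hyb⟩
  have hfy : f⁻¹.1 y ∈ Set.Ioo c b :=
    ⟨(lt_inv_iff f).2 hcy, (h2.inv_apply_mem ⟨hac.trans hy.1, hyb⟩).2⟩
  obtain ⟨m, hm⟩ := h1.exists_lt_pow_apply hfy hyb
  -- `f * (k ^ m)⁻¹` moves `c` to the right but `y` to the left.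
  have hpG : f * (k ^ m)⁻¹ ∈ G := G.mul_mem hf (G.inv_mem (G.pow_mem hk m))
  have hkc : (k ^ m)⁻¹.1 c = c := by
    apply inv_fixed
    rw [pow_apply]
    exact Function.IsFixedPt.iterate h1.2.1 m
  have hpc : c < (f * (k ^ m)⁻¹).1 c := by
    rw [mul_apply, hkc]
    exact hcf
  have hpy : (f * (k ^ m)⁻¹).1 y < y := by
    rw [mul_apply, ← lt_inv_iff, inv_lt_iff]
    exact hm
  obtain ⟨z, hz, hpz⟩ := exists_fixed _ hpc.le hpy.le
  rw [Set.uIcc_of_le hy.1.le] at hz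
  have hzc : c < z := lt_of_le_of_ne hz.1 fun h => hpc.ne' (h.symm ▸ hpz)
  obtain ⟨q, hq, a', b', hb, ha', hb', hfix⟩ := exists_isBump hpG hpc.ne'
  have hza : b' ≤ z := (hb.le_or_le (hfix z hpz)).resolve_left (ha'.trans hzc).not_ge
  exact hG hq hk hb h1 ha' hb' (hza.trans_lt (hz.2.trans_lt hyb))

theorem NoOverlap.right_eq (hG : NoOverlap G) {f k : PLo} (hf : f ∈ G) (hk : k ∈ G)
    {b c d : I} (h1 : IsBump k c d) (h2 : IsBump f c b) : d = b :=
  le_antisymm (not_lt.1 (hG.not_lt_right hk hf h2 h1)) (not_lt.1 (hG.not_lt_right hf hk h1 h2))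

theorem NoOverlap.left_eq (hG : NoOverlap G) {f k : PLo} (hf : f ∈ G) (hk : k ∈ G)
    {a b c : I} (h1 : IsBump k c b) (h2 : IsBump f a b) : a = c :=
  le_antisymm (not_lt.1 (hG.not_lt_left hk hf h2 h1)) (not_lt.1 (hG.not_lt_left hf hk h1 h2))

/-- A bump throws every bump strictly inside it off itself, since otherwise that inner bump would
overlap its own image. -/
theorem NoOverlap.le_apply (hG : NoOverlap G) {f k : PLo} (hf : f ∈ G) (hk : k ∈ G)
    {a b c d : I} (h1 : IsBump f a b) (h2 : IsBump k c d) (hac : a < c) (hdb : d < b) :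
    d ≤ f.1 c := by
  by_contra! hlt
  exact hG hk (G.mul_mem (G.mul_mem hf hk) (G.inv_mem hf)) h2 (h2.conj f)
    (h1.2.2.2 c ⟨hac, h2.1.trans hdb⟩) hlt (h1.2.2.2 d ⟨hac.trans h2.1, hdb⟩)

/-- There are only countably many orbitals: the bumps around a given point are nested with gaps. -/
theorem NoOverlap.countable_bumps (hG : NoOverlap G) :
    {p : I × I | ∃ f ∈ G, IsBump f p.1 p.2}.Countable := by
  obtain ⟨D, hDc, hD⟩ := TopologicalSpace.exists_countable_dense I
  have hq : ∀ q : I, {p : I × I | (∃ f ∈ G, IsBump f p.1 p.2) ∧ p.1 < q ∧ q < p.2}.Countable := by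
    intro q
    choose! F hFG hF using fun (p : I × I) (h : ∃ f ∈ G, IsBump f p.1 p.2) => h
    -- The bumps around `q` are nested, and `F p` throws the smaller ones off themselves; so the
    -- gaps `(p.1, (F p)⁻¹ q)` that they leave at the left end of `p` are disjoint.
    refine Set.PairwiseDisjoint.countable_of_isOpen
      (s := fun p : I × I => Set.Ioo p.1 ((F p)⁻¹.1 q)) ?_ (fun _ _ => isOpen_Ioo) ?_
    · have key : ∀ p p' : I × I, (∃ f ∈ G, IsBump f p.1 p.2) → (∃ f ∈ G, IsBump f p'.1 p'.2) →
          q < p.2 → p.1 < q → q < p'.2 → p'.1 < p.1 →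
          Disjoint (Set.Ioo p.1 ((F p)⁻¹.1 q)) (Set.Ioo p'.1 ((F p')⁻¹.1 q)) := by
        intro p p' hp hp' h1 h2 h3 h4
        have hle : p.2 ≤ p'.2 :=
          not_lt.1 fun h => hG (hFG p' hp') (hFG p hp) (hF p' hp') (hF p hp) h4 (h2.trans h3) h
        have hlt : p.2 < p'.2 := by
          refine lt_of_le_of_ne hle fun h => ?_
          have hb := hF p hp
          rw [h] at hb
          exact h4.ne (hG.left_eq (hFG p' hp') (hFG p hp) hb (hF p' hp'))
        have h5 := hG.le_apply (hFG p' hp') (hFG p hp) (hF p' hp') (hF p hp) h4 hlt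
        have h6 : (F p')⁻¹.1 q < p.1 := (inv_lt_iff _).2 (h1.trans_le h5)
        rw [Set.disjoint_left]
        exact fun y hy hy' => absurd (hy.1.trans hy'.2) h6.not_gt
      rintro p ⟨hp, hp1, hp2⟩ p' ⟨hp', hp1', hp2'⟩ hne
      rcases lt_trichotomy p.1 p'.1 with h | h | h
      · exact (key p' p hp' hp hp2' hp1' hp2 h).symm
      · refine absurd (Prod.ext h ?_) hne
        have hb := hF p hp
        rw [h] at hb
        exact hG.right_eq (hFG p' hp') (hFG p hp) hb (hF p' hp')
      · exact key p p' hp hp' hp2 hp1 hp2' h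
    · rintro p ⟨hp, hp1, hp2⟩
      exact Set.nonempty_Ioo.2 ((hF p hp).inv_apply_mem ⟨hp1, hp2⟩).1
  refine (hDc.biUnion fun q _ => hq q).mono ?_
  rintro p ⟨f, hf, hp⟩
  obtain ⟨q, hqD, hq'⟩ := hD.exists_between hp.1
  exact Set.mem_biUnion hqD ⟨⟨f, hf, hp⟩, hq'.1, hq'.2⟩

/-! ### Affine pieces and one-sided slopes -/

theorem exists_affine_of_locally_affine {g : ℝ → ℝ} {a b : ℝ}
    (h : ∀ x ∈ Set.Ioo a b, ∃ m c : ℝ, ∀ᶠ y in 𝓝 x, g y = m * y + c) :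
    ∃ m c : ℝ, ∀ x ∈ Set.Ioo a b, g x = m * x + c := by
  have hderiv : ∀ x ∈ Set.Ioo a b, ∃ m, HasDerivAt g m x ∧ ∀ᶠ y in 𝓝 x, deriv g y = m := by
    intro x hx
    obtain ⟨m, c, hg⟩ := h x hx
    have key : ∀ᶠ y in 𝓝 x, HasDerivAt g m y := by
      filter_upwards [hg.eventually_nhds] with y hy
      have h1 : HasDerivAt (fun z : ℝ => m * z + c) m y := by
        simpa using ((hasDerivAt_id y).const_mul m).add_const c
      exact h1.congr_of_eventuallyEq hy
    exact ⟨m, key.self_of_nhds, key.mono fun y hy => hy.deriv⟩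
  -- The derivative of `g` is locally constant, hence constant.
  obtain ⟨m, hm⟩ := isOpen_Ioo.exists_is_const_of_deriv_eq_zero (f := deriv g)
    isPreconnected_Ioo (fun x hx => by
      obtain ⟨m, -, h2⟩ := hderiv x hx
      exact ((differentiableAt_const m).congr_of_eventuallyEq h2).differentiableWithinAt)
    (fun x hx => by
      obtain ⟨m, -, h2⟩ := hderiv x hx
      exact (Filter.EventuallyEq.deriv_eq h2).trans (deriv_const x m))
  obtain ⟨c, hc⟩ := isOpen_Ioo.exists_is_const_of_deriv_eq_zero (f := fun x => g x - m * x)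
    (s := Set.Ioo a b) isPreconnected_Ioo (fun x hx => by
      obtain ⟨m', h1, -⟩ := hderiv x hx
      exact (h1.differentiableAt.sub
        (differentiableAt_id.const_mul m)).differentiableWithinAt)
    (fun x hx => by
      obtain ⟨m', h1, -⟩ := hderiv x hx
      have h2 := h1.sub ((hasDerivAt_id x).const_mul m)
      have h3 := hm x hx
      rw [h1.deriv] at h3
      have h4 := h2.deriv
      rw [h3, mul_one, sub_self] at h4
      exact h4)
  exact ⟨m, c, fun x hx => by linarith [hc x hx]⟩

/-- The conclusion is stated with differences, so that it composes without tracking constants. -/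
theorem exists_affine_Icc (f : PLo) {a b : I} (hab : a < b)
    (h : ∀ x ∈ Set.Ioo a b, x ∉ breakpoints f.1) :
    ∃ m : ℝ, ∀ x ∈ Set.Icc a b, ∀ y ∈ Set.Icc a b,
      (f.1 x : ℝ) - f.1 y = m * ((x : ℝ) - y) := by
  obtain ⟨m, c, hmc⟩ := exists_affine_of_locally_affine (a := a) (b := b)
    (g := fun x : ℝ => (f.1 (Set.projIcc 0 1 zero_le_one x) : ℝ)) (by
      intro x hx
      have hxI : x ∈ Set.Ioo (0 : ℝ) 1 := ⟨a.2.1.trans_lt hx.1, hx.2.trans_le b.2.2⟩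
      have hproj : Set.projIcc 0 1 zero_le_one x = (⟨x, hxI.1.le, hxI.2.le⟩ : I) :=
        Set.projIcc_of_mem _ _
      have haff : AffineNear f.1 (Set.projIcc 0 1 zero_le_one x) := by
        rw [hproj]
        exact not_not.1 (h ⟨x, hxI.1.le, hxI.2.le⟩ hx)
      obtain ⟨m, c, hm⟩ := haff
      refine ⟨m, c, ?_⟩
      filter_upwards [continuous_projIcc.continuousAt.eventually hm,
        isOpen_Ioo.mem_nhds hxI] with y hy hyI
      rw [hy, Set.projIcc_of_mem _ (Set.Ioo_subset_Icc_self hyI)])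
  have hopen : ∀ x ∈ Set.Ioo a b, (f.1 x : ℝ) = m * x + c := by
    intro x hx
    have := hmc x hx
    rwa [Set.projIcc_val] at this
  have hclosed : ∀ x ∈ Set.Icc a b, (f.1 x : ℝ) = m * x + c := by
    have hcl : IsClosed {x : I | (f.1 x : ℝ) = m * x + c} :=
      isClosed_eq (continuous_subtype_val.comp (cont f)) (by fun_prop)
    have := closure_minimal hopen hcl
    rwa [closure_Ioo hab.ne] at this
  exact ⟨m, fun x hx y hy => by rw [hclosed x hx, hclosed y hy]; ring⟩

theorem exists_Ioo_disjoint_right {E : Set I} (hE : E.Finite) {t u : I} (htu : t < u) :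
    ∃ v, t < v ∧ v < u ∧ ∀ x ∈ Set.Ioo t v, x ∉ E := by
  have h1 : ∀ᶠ y in 𝓝[>] t, y ∉ E \ {t} :=
    nhdsWithin_le_nhds ((hE.subset Set.sdiff_subset).isClosed.isOpen_compl.mem_nhds (by simp))
  obtain ⟨w, hw, hsub⟩ := (mem_nhdsGT_iff_exists_Ioo_subset' htu).1 h1
  obtain ⟨v, hv1, hv2⟩ := exists_between (lt_min (Set.mem_Ioi.1 hw) htu)
  refine ⟨v, hv1, hv2.trans_le (min_le_right _ _), fun x hx hxE => ?_⟩
  exact hsub ⟨hx.1, hx.2.trans (hv2.trans_le (min_le_left _ _))⟩ ⟨hxE, hx.1.ne'⟩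

theorem exists_Ioo_disjoint_left {E : Set I} (hE : E.Finite) {t u : I} (hut : u < t) :
    ∃ v, v < t ∧ u < v ∧ ∀ x ∈ Set.Ioo v t, x ∉ E := by
  have h1 : ∀ᶠ y in 𝓝[<] t, y ∉ E \ {t} :=
    nhdsWithin_le_nhds ((hE.subset Set.sdiff_subset).isClosed.isOpen_compl.mem_nhds (by simp))
  obtain ⟨w, hw, hsub⟩ := (mem_nhdsLT_iff_exists_Ioo_subset' hut).1 h1
  obtain ⟨v, hv1, hv2⟩ := exists_between (max_lt (Set.mem_Iio.1 hw) hut)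
  refine ⟨v, hv2, (le_max_right _ _).trans_lt hv1, fun x hx hxE => ?_⟩
  exact hsub ⟨((le_max_left _ _).trans_lt hv1).trans hx.1, hx.2⟩ ⟨hxE, hx.2.ne⟩

/-- `m` is the slope of `f` immediately to the right of `t`. At `t = 1`, where there is nothing to
the right, this holds for every `m`. -/
def IsRightSlope (f : PLo) (t : I) (m : ℝ) : Prop :=
  ∀ᶠ y in 𝓝[>] t, (f.1 y : ℝ) = f.1 t + m * ((y : ℝ) - t)

theorem exists_isRightSlope (f : PLo) (t : I) : ∃ m, IsRightSlope f t m := by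
  rcases eq_or_lt_of_le (show t ≤ 1 from t.2.2) with rfl | ht
  · refine ⟨0, ?_⟩
    filter_upwards [self_mem_nhdsWithin] with y hy
    exact absurd (show y ≤ 1 from y.2.2) (Set.mem_Ioi.1 hy).not_ge
  · obtain ⟨v, hv, -, hE⟩ := exists_Ioo_disjoint_right f.2.2 ht
    obtain ⟨m, hm⟩ := exists_affine_Icc f hv hE
    refine ⟨m, ?_⟩
    filter_upwards [Ioo_mem_nhdsGT hv] with y hy
    linarith [hm y ⟨hy.1.le, hy.2.le⟩ t ⟨le_rfl, hv.le⟩]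

theorem tendsto_nhdsGT (f : PLo) (t : I) : Filter.Tendsto f.1 (𝓝[>] t) (𝓝[>] (f.1 t)) :=
  tendsto_nhdsWithin_iff.2 ⟨(cont f).continuousAt.tendsto.mono_left nhdsWithin_le_nhds,
    by filter_upwards [self_mem_nhdsWithin] with y hy using (lt_iff f).2 hy⟩

theorem IsRightSlope.mul {f g : PLo} {t : I} {m n : ℝ} (hf : IsRightSlope f (g.1 t) m)
    (hg : IsRightSlope g t n) : IsRightSlope (f * g) t (m * n) := by
  filter_upwards [hg, (tendsto_nhdsGT g t).eventually hf] with y h1 h2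
  rw [mul_apply, mul_apply, h2, h1]
  ring

/-- Elements that agree at `t` but leave it with different slopes produce a bump with left end
`t`. -/
theorem IsRightSlope.exists_isBump {f g : PLo} {t : I} {m n : ℝ} (hf : IsRightSlope f t m)
    (hg : IsRightSlope g t n) (hfg : f.1 t = g.1 t) (ht : t < 1) (hmn : m < n) :
    ∃ b, IsBump (f⁻¹ * g) t b := by
  have hev : ∀ᶠ y in 𝓝[>] t, y < (f⁻¹ * g).1 y := by
    filter_upwards [hf, hg, self_mem_nhdsWithin] with y h1 h2 h3
    rw [mul_apply, lt_inv_iff, ← Subtype.coe_lt_coe, h1, h2, hfg]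
    have : (0 : ℝ) < y - t := sub_pos.2 h3
    nlinarith
  obtain ⟨u, hu, hsub⟩ := (mem_nhdsGT_iff_exists_Ioo_subset' ht).1 hev
  obtain ⟨x, hx⟩ := exists_between (Set.mem_Ioi.1 hu)
  have htfix : (f⁻¹ * g).1 t = t := by rw [mul_apply, ← hfg, inv_apply_self]
  obtain ⟨a, b, hb, hax, hxb⟩ := exists_isBump_of_lt _ (hsub hx)
  have hta : t ≤ a := (hb.le_or_le htfix).resolve_right (hx.1.trans hxb).not_ge
  have hat : a = t := by
    refine (hta.eq_or_lt.resolve_right fun h => ?_).symm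
    exact (hsub ⟨h, hax.trans hx.2⟩ : a < _).ne' hb.2.1
  exact ⟨b, hat ▸ hb⟩

/-! ### Elements with a common bump displace points by a definite amount -/

/-- A power of `f` is affine on `[c, d]` if `f` is affine on the images of `[c, d]` under the
smaller powers. -/
theorem pow_affine (f : PLo) {c d : I}
    (h : ∀ n : ℕ, ∃ m : ℝ, ∀ x ∈ Set.Icc c d, ∀ y ∈ Set.Icc c d,
      (f.1 ((f ^ n).1 x) : ℝ) - f.1 ((f ^ n).1 y) = m * (((f ^ n).1 x : ℝ) - (f ^ n).1 y))
    (n : ℕ) : ∃ m : ℝ, ∀ x ∈ Set.Icc c d, ∀ y ∈ Set.Icc c d,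
      ((f ^ n).1 x : ℝ) - (f ^ n).1 y = m * ((x : ℝ) - y) := by
  induction n with
  | zero => exact ⟨1, fun x _ y _ => (one_mul _).symm⟩
  | succ n ih =>
    obtain ⟨m, hm⟩ := ih
    obtain ⟨m', hm'⟩ := h n
    refine ⟨m' * m, fun x hx y hy => ?_⟩
    rw [pow_succ', mul_apply, mul_apply, hm' x hx y hy, hm x hx y hy, mul_assoc]

/-- Suppose that `p` is affine on `[c, d]`, commutes with `h` at `z` and `w`, and carries these
points to a pair over which `h` has slope `s`. If `h` maps `z` and `w` into `[c, d]`, then its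
slope over `z` and `w` is `s` as well. -/
theorem quotient_eq_slope {p h : PLo} {c d z w : I} {s M : ℝ}
    (hM : ∀ x ∈ Set.Icc c d, ∀ y ∈ Set.Icc c d, (p.1 x : ℝ) - p.1 y = M * ((x : ℝ) - y))
    (hz : z ∈ Set.Icc c d) (hw : w ∈ Set.Icc c d) (hhz : h.1 z ∈ Set.Icc c d)
    (hhw : h.1 w ∈ Set.Icc c d) (hzw : z < w)
    (hcz : h.1 (p.1 z) = p.1 (h.1 z)) (hcw : h.1 (p.1 w) = p.1 (h.1 w))
    (hs : (h.1 (p.1 w) : ℝ) - h.1 (p.1 z) = s * ((p.1 w : ℝ) - p.1 z)) :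
    (h.1 w : ℝ) - h.1 z = s * ((w : ℝ) - z) := by
  have h1 := hM w hw z hz
  have h2 := hM _ hhw _ hhz
  have hpos : (0 : ℝ) < (p.1 w : ℝ) - p.1 z := sub_pos.2 ((lt_iff p).2 hzw)
  have hM0 : M ≠ 0 := by
    rintro rfl
    rw [h1, zero_mul] at hpos
    exact lt_irrefl _ hpos
  rw [hcz, hcw, h2, h1] at hs
  apply mul_left_cancel₀ hM0
  rw [hs]
  ring

/-- If no element of `G` has a bump properly inside `(a, b)`, then elements with bump `(a, b)`
commute there: their commutator is trivial near `a`, because slopes commute. -/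
theorem apply_comm_of_no_smaller_bump {f h : PLo} {a b : I} (hf : f ∈ G) (hh : h ∈ G)
    (hfb : IsBump f a b) (hhb : IsBump h a b)
    (hno : ∀ k ∈ G, ∀ c d, IsBump k c d → a ≤ c → d ≤ b → c = a ∧ d = b)
    {y : I} (hy : y ∈ Set.Ioo a b) : h.1 (f.1 y) = f.1 (h.1 y) := by
  by_contra hne
  have hpG : (f * h)⁻¹ * (h * f) ∈ G :=
    G.mul_mem (G.inv_mem (G.mul_mem hf hh)) (G.mul_mem hh hf)
  have hp : ∀ x, ((f * h)⁻¹ * (h * f)).1 x = x ↔ h.1 (f.1 x) = f.1 (h.1 x) := by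
    intro x
    rw [← (f * h).1.injective.eq_iff, ← mul_apply (f * h), mul_inv_cancel_left, mul_apply,
      mul_apply]
  obtain ⟨k, hk, c, d, hkb, hcy, hyd, hfix⟩ := exists_isBump hpG (mt (hp y).1 hne)
  have hc : a ≤ c := (hkb.le_or_le (hfix a ((hp a).2
    (by rw [hfb.2.1, hhb.2.1, hfb.2.1])))).resolve_right (hy.1.trans hyd).not_ge
  have hd : d ≤ b := (hkb.le_or_le (hfix b ((hp b).2
    (by rw [hfb.2.2.1, hhb.2.2.1, hfb.2.2.1])))).resolve_left (hcy.trans hy.2).not_ge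
  obtain ⟨rfl, rfl⟩ := hno k hk c d hkb hc hd
  obtain ⟨m, hm⟩ := exists_isRightSlope f c
  obtain ⟨n, hn⟩ := exists_isRightSlope h c
  have h1 := IsRightSlope.mul (f := f) (g := h) (by rwa [hhb.2.1]) hn
  have h2 := IsRightSlope.mul (f := h) (g := f) (by rwa [hfb.2.1]) hm
  have : ∀ᶠ x in 𝓝[>] c, False := by
    filter_upwards [h1, h2, Ioo_mem_nhdsGT hkb.1] with x h3 h4 h5
    refine (hkb.2.2.2 x h5).ne' (hfix x ((hp x).2 (Subtype.ext ?_)))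
    rw [mul_apply, mul_apply] at h3 h4
    rw [h3, h4, hfb.2.1, hhb.2.1, hfb.2.1, mul_comm m n]
  have hne : (𝓝[>] c).NeBot := nhdsGT_neBot_of_exists_gt ⟨_, hkb.1⟩
  exact (hne.ne (Filter.eventually_false_iff_eq_bot.1 this))

/-- If no element of `G` has a bump properly inside `(a, b)`, then an element `h` with bump
`(a, b)` cannot move points too little. Choose a short interval `[c, d]` on which all powers of
some `f` with bump `(a, b)` are affine. If `h` moved some pair of points within `[c, d]`, then,
`h` and `f` commuting, its difference quotient there would be both its slope at `a`, which is
greater than `1`, and its slope at `b`, which is less than `1`. -/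
theorem exists_le_apply_of_no_smaller_bump {f : PLo} {a b : I} (hf : f ∈ G)
    (hfb : IsBump f a b)
    (hno : ∀ k ∈ G, ∀ c d, IsBump k c d → a ≤ c → d ≤ b → c = a ∧ d = b) :
    ∃ c d, a < c ∧ c < d ∧ d < b ∧ ∀ h ∈ G, IsBump h a b → d ≤ h.1 c := by
  obtain ⟨u, hau, hub, hu⟩ := exists_Ioo_disjoint_right f.2.2 hfb.1
  obtain ⟨l, hlb, hul, hl⟩ := exists_Ioo_disjoint_left f.2.2 hub
  obtain ⟨c, hac, hcu⟩ := exists_between hau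
  have hc : c ∈ Set.Ioo a b := ⟨hac, hcu.trans hub⟩
  obtain ⟨N, hN⟩ := hfb.exists_lt_pow_apply hc hlb
  -- From the `N`-th power on, the points above `c` are carried beyond the last breakpoint of `f`
  -- in `(a, b)`, so that `[c, d]` has to avoid only the preimages under finitely many powers.
  have hEfin : (⋃ n ∈ Set.Iio N, (f ^ n).1 ⁻¹' breakpoints f.1).Finite :=
    (Set.finite_Iio N).biUnion fun n _ => f.2.2.preimage (f ^ n).1.injective.injOn
  obtain ⟨d, hcd, hdu, hd⟩ := exists_Ioo_disjoint_right hEfin hcu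
  have hdmem : d ∈ Set.Ioo a b := ⟨hac.trans hcd, hdu.trans hub⟩
  have hsub : ∀ x ∈ Set.Icc c d, x ∈ Set.Ioo a b := fun x hx =>
    ⟨hac.trans_le hx.1, hx.2.trans_lt hdmem.2⟩
  have hpos := pow_affine f (c := c) (d := d) (fun n => by
    obtain ⟨m, hm⟩ := exists_affine_Icc f ((lt_iff (f ^ n)).2 hcd) (by
      intro x hx hxb
      rcases lt_or_ge n N with h | h
      · refine hd ((f ^ n)⁻¹.1 x) ⟨(lt_inv_iff _).2 hx.1, (inv_lt_iff _).2 hx.2⟩ ?_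
        refine Set.mem_biUnion (show n ∈ Set.Iio N from h) ?_
        rw [Set.mem_preimage, apply_inv_self]
        exact hxb
      · refine hl x ⟨?_, hx.2.trans (hfb.pow_apply_mem hdmem n).2⟩ hxb
        exact hN.trans_le ((hfb.monotone_pow_apply hc h).trans hx.1.le))
    exact ⟨m, fun x hx y hy => hm _ ⟨(le_iff _).2 hx.1, (le_iff _).2 hx.2⟩ _
      ⟨(le_iff _).2 hy.1, (le_iff _).2 hy.2⟩⟩)
  obtain ⟨m, hm⟩ := exists_affine_Icc f hau hu
  -- The powers of `f⁻¹` keep `[c, d]` inside `[a, u]`, where `f` is affine.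
  have hinv_le : ∀ n : ℕ, ∀ x ∈ Set.Icc c d, (f⁻¹ ^ n).1 x ∈ Set.Ioo a u := by
    intro n x hx
    induction n with
    | zero => exact ⟨hac.trans_le hx.1, hx.2.trans_lt hdu⟩
    | succ n ih =>
      have hmem : (f⁻¹ ^ n).1 x ∈ Set.Ioo a b := ⟨ih.1, ih.2.trans hub⟩
      rw [pow_succ', mul_apply]
      refine ⟨(hfb.inv_apply_mem hmem).1, lt_trans ?_ ih.2⟩
      exact (inv_lt_iff f).2 (hfb.2.2.2 _ hmem)
  have hneg := pow_affine f⁻¹ (c := c) (d := d) (fun n => by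
    refine ⟨m⁻¹, fun x hx y hy => ?_⟩
    have hx' := hinv_le (n + 1) x hx
    have hy' := hinv_le (n + 1) y hy
    rw [pow_succ', mul_apply] at hx' hy'
    have h1 := hm _ ⟨hx'.1.le, hx'.2.le⟩ _ ⟨hy'.1.le, hy'.2.le⟩
    have hm0 : m ≠ 0 := by
      rintro rfl
      have h2 := hm u ⟨hau.le, le_rfl⟩ a ⟨le_rfl, hau.le⟩
      rw [zero_mul, sub_eq_zero] at h2
      exact hau.ne' (f.1.injective (Subtype.ext h2))
    rw [apply_inv_self, apply_inv_self] at h1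
    rw [h1, inv_mul_cancel_left₀ hm0])
  refine ⟨c, d, hac, hcd, hdmem.2, fun h hh hhb => ?_⟩
  by_contra! hlt
  obtain ⟨w, hcw, hw⟩ := exists_between (lt_min hcd ((lt_inv_iff h).2 hlt))
  have hwd : w < d := hw.trans_le (min_le_left _ _)
  have hhw : h.1 w < d := (lt_inv_iff h).1 (hw.trans_le (min_le_right _ _))
  have hzI : c ∈ Set.Icc c d := ⟨le_rfl, hcd.le⟩
  have hwI : w ∈ Set.Icc c d := ⟨hcw.le, hwd.le⟩
  have hhzI : h.1 c ∈ Set.Icc c d := ⟨(hhb.2.2.2 c hc).le, hlt.le⟩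
  have hhwI : h.1 w ∈ Set.Icc c d := ⟨hcw.le.trans (hhb.2.2.2 w (hsub w hwI)).le, hhw.le⟩
  have hcomm : ∀ n : ℕ, ∀ y ∈ Set.Ioo a b, h.1 ((f ^ n).1 y) = (f ^ n).1 (h.1 y) := by
    intro n y hy
    induction n with
    | zero => rfl
    | succ n ih =>
      rw [pow_succ', mul_apply, mul_apply, ← ih]
      exact apply_comm_of_no_smaller_bump hf hh hfb hhb hno (hfb.pow_apply_mem hy n)
  have hcomm' : ∀ n : ℕ, ∀ y ∈ Set.Icc c d,
      h.1 ((f⁻¹ ^ n).1 y) = (f⁻¹ ^ n).1 (h.1 y) := by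
    intro n y hy
    have hmem : (f⁻¹ ^ n).1 y ∈ Set.Ioo a b :=
      ⟨(hinv_le n y hy).1, (hinv_le n y hy).2.trans hub⟩
    have h1 := hcomm n _ hmem
    rw [inv_pow] at h1 ⊢
    rw [apply_inv_self] at h1
    rw [h1, inv_apply_self]
  have hcw_pos : (0 : ℝ) < (w : ℝ) - c := sub_pos.2 hcw
  -- High powers of `f⁻¹` carry `c` and `w` close to `a`, where `h` has slope greater than `1`.
  have hgt : (w : ℝ) - c < (h.1 w : ℝ) - h.1 c := by
    obtain ⟨v, hav, hvb, hv⟩ := exists_Ioo_disjoint_right h.2.2 hhb.1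
    obtain ⟨s, hs⟩ := exists_affine_Icc h hav hv
    obtain ⟨n, hn⟩ := hfb.exists_lt_pow_apply ⟨hav, hvb⟩ hdmem.2
    have hmemv : ∀ x ∈ Set.Icc c d, (f⁻¹ ^ n).1 x ∈ Set.Icc a v := by
      intro x hx
      refine ⟨(hinv_le n x hx).1.le, ?_⟩
      rw [inv_pow]
      exact ((inv_lt_iff (f ^ n)).2 (hx.2.trans_lt hn)).le
    obtain ⟨M, hM⟩ := hneg n
    rw [quotient_eq_slope hM hzI hwI hhzI hhwI hcw (hcomm' n c hzI) (hcomm' n w hwI)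
      (hs _ (hmemv w hwI) _ (hmemv c hzI))]
    have h1 := hs v ⟨hav.le, le_rfl⟩ a ⟨le_rfl, hav.le⟩
    have h2 : (v : ℝ) < h.1 v := hhb.2.2.2 v ⟨hav, hvb⟩
    rw [hhb.2.1] at h1
    have h3 : (0 : ℝ) < (v : ℝ) - a := sub_pos.2 hav
    have hs1 : 1 < s := by
      by_contra! hle
      nlinarith
    nlinarith
  -- High powers of `f` carry them close to `b`, where `h` has slope less than `1`.
  have hlt' : (h.1 w : ℝ) - h.1 c < (w : ℝ) - c := by
    obtain ⟨v, hvb, hav, hv⟩ := exists_Ioo_disjoint_left h.2.2 hhb.1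
    obtain ⟨s, hs⟩ := exists_affine_Icc h hvb hv
    obtain ⟨n, hn⟩ := hfb.exists_lt_pow_apply hc hvb
    have hmemv : ∀ x ∈ Set.Icc c d, (f ^ n).1 x ∈ Set.Icc v b := fun x hx =>
      ⟨hn.le.trans ((le_iff _).2 hx.1), (hfb.pow_apply_mem (hsub x hx) n).2.le⟩
    obtain ⟨M, hM⟩ := hpos n
    rw [quotient_eq_slope hM hzI hwI hhzI hhwI hcw (hcomm n c hc) (hcomm n w (hsub w hwI))
      (hs _ (hmemv w hwI) _ (hmemv c hzI))]
    have h1 := hs v ⟨le_rfl, hvb.le⟩ b ⟨hvb.le, le_rfl⟩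
    have h2 : (v : ℝ) < h.1 v := hhb.2.2.2 v ⟨hav, hvb⟩
    rw [hhb.2.2.1] at h1
    have h3 : (0 : ℝ) < (b : ℝ) - v := sub_pos.2 hvb
    have hs1 : s < 1 := by
      by_contra! hle
      nlinarith
    nlinarith
  exact lt_asymm hgt hlt'

/-- The elements of `G` with bump `(a, b)` displace some point of it by a definite amount. If there
is a bump of `G` properly inside `(a, b)`, its left end is such a point. -/
theorem NoOverlap.exists_le_apply (hG : NoOverlap G) {f : PLo} (hf : f ∈ G) {a b : I}
    (hfb : IsBump f a b) :
    ∃ c d, a < c ∧ c < d ∧ d < b ∧ ∀ h ∈ G, IsBump h a b → d ≤ h.1 c := by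
  by_cases hno : ∀ k ∈ G, ∀ c d, IsBump k c d → a ≤ c → d ≤ b → c = a ∧ d = b
  · exact exists_le_apply_of_no_smaller_bump hf hfb hno
  · push Not at hno
    obtain ⟨k, hk, c, d, hkb, hac, hdb, hne⟩ := hno
    have hac' : a < c := by
      refine lt_of_le_of_ne hac ?_
      rintro rfl
      exact hne rfl (hG.right_eq hf hk hkb hfb)
    have hdb' : d < b := by
      refine lt_of_le_of_ne hdb ?_
      rintro rfl
      exact hac'.ne (hG.left_eq hf hk hkb hfb)
    exact ⟨c, d, hac', hkb.1, hdb', fun h hh hhb => hG.le_apply hh hk hhb hkb hac' hdb'⟩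

/-! ### Countability -/

/-- Elements with different slopes at `t` differ by an element with the bump at `t`, so they map
`(c, d)` to disjoint intervals. -/
theorem NoOverlap.countable_rightSlopes (hG : NoOverlap G) {U : Set PLo} (hU : U ⊆ G) {t : I}
    (ht : t < 1) (hUt : ∀ f ∈ U, ∀ g ∈ U, f.1 t = g.1 t) :
    {m | ∃ f ∈ U, IsRightSlope f t m}.Countable := by
  by_cases hsub : {m | ∃ f ∈ U, IsRightSlope f t m}.Subsingleton
  · exact hsub.countable
  have hbump : ∀ {f g m n}, f ∈ U → g ∈ U → IsRightSlope f t m → IsRightSlope g t n → m < n →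
      f⁻¹ * g ∈ G ∧ ∃ b, IsBump (f⁻¹ * g) t b := fun hf hg hm hn hmn =>
    ⟨G.mul_mem (G.inv_mem (hU hf)) (hU hg), hm.exists_isBump hn (hUt _ hf _ hg) ht hmn⟩
  rw [Set.not_subsingleton_iff] at hsub
  obtain ⟨m, ⟨f, hf, hm⟩, n, ⟨g, hg, hn⟩, hmn⟩ := hsub.exists_lt
  obtain ⟨hkG, b, hk⟩ := hbump hf hg hm hn hmn
  obtain ⟨c, d, -, hcd, -, hle⟩ := hG.exists_le_apply hkG hk
  choose! F hFU hF using fun (m : ℝ) (h : ∃ f ∈ U, IsRightSlope f t m) => h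
  have key : ∀ m n, (∃ f ∈ U, IsRightSlope f t m) → (∃ f ∈ U, IsRightSlope f t n) → m < n →
      Disjoint (Set.Ioo ((F m).1 c) ((F m).1 d)) (Set.Ioo ((F n).1 c) ((F n).1 d)) := by
    intro m n hm hn hmn
    -- Two bumps with the same left end coincide, so `c` and `d` serve for this one too.
    obtain ⟨hkG', b', hk'⟩ := hbump (hFU m hm) (hFU n hn) (hF m hm) (hF n hn) hmn
    obtain rfl : b' = b := hG.right_eq hkG hkG' hk' hk
    have h1 := hle _ hkG' hk'
    rw [mul_apply, ← le_iff (F m), apply_inv_self] at h1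
    rw [Set.disjoint_left]
    exact fun y hy hy' => absurd (hy'.1.trans hy.2) h1.not_gt
  refine Set.PairwiseDisjoint.countable_of_isOpen
    (s := fun m : ℝ => Set.Ioo ((F m).1 c) ((F m).1 d)) ?_ (fun _ _ => isOpen_Ioo)
    (fun m _ => Set.nonempty_Ioo.2 ((lt_iff _).2 hcd))
  intro m hm n hn hne
  rcases hne.lt_or_gt with h | h
  · exact key m n hm hn h
  · exact (key n m hn hm h).symm

theorem IsRightSlope.apply_eq {f : PLo} {t x : I} {m : ℝ} (hm : IsRightSlope f t m) (htx : t < x)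
    (hE : ∀ y ∈ Set.Ioo t x, y ∉ breakpoints f.1) {y : I} (hy : y ∈ Set.Icc t x) :
    (f.1 y : ℝ) = f.1 t + m * ((y : ℝ) - t) := by
  obtain ⟨s, hs⟩ := exists_affine_Icc f htx hE
  have hne : (𝓝[>] t).NeBot := nhdsGT_neBot_of_exists_gt ⟨x, htx⟩
  obtain ⟨z, hz, hzI⟩ := (hm.and (Ioo_mem_nhdsGT htx)).exists
  have h1 := hs z ⟨hzI.1.le, hzI.2.le⟩ t ⟨le_rfl, htx.le⟩
  have h2 : (z : ℝ) - t ≠ 0 := (sub_pos.2 (Subtype.coe_lt_coe.2 hzI.1)).ne'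
  have h3 : s = m := mul_right_cancel₀ h2 (by linarith)
  have h4 := hs y hy t ⟨le_rfl, htx.le⟩
  rw [h3] at h4
  linarith

theorem IsRightSlope.eqOn {f g : PLo} {t x : I} {m : ℝ} (hf : IsRightSlope f t m)
    (hg : IsRightSlope g t m) (hfg : ∀ y ≤ t, f.1 y = g.1 y) (htx : t < x)
    (hfE : ∀ y ∈ Set.Ioo t x, y ∉ breakpoints f.1) (hgE : ∀ y ∈ Set.Ioo t x, y ∉ breakpoints g.1)
    {y : I} (hy : y ≤ x) : f.1 y = g.1 y := by
  rcases le_total y t with h | h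
  · exact hfg y h
  · apply Subtype.ext
    rw [hf.apply_eq htx hfE ⟨h, hy⟩, hg.apply_eq htx hgE ⟨h, hy⟩, hfg t le_rfl]

/-- Two elements that agree up to a point that is a breakpoint of one of them only produce a bump
whose left end is that point. -/
theorem exists_isBump_of_breakpoint {f g : PLo} (hf : f ∈ G) (hg : g ∈ G) {x : I} (hx : x < 1)
    (hfg : ∀ y ≤ x, f.1 y = g.1 y) (hxf : x ∈ breakpoints f.1) (hxg : x ∉ breakpoints g.1) :
    ∃ h ∈ G, ∃ b, IsBump h x b := by
  obtain ⟨m, hm⟩ := exists_isRightSlope f x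
  obtain ⟨n, hn⟩ := exists_isRightSlope g x
  rcases lt_trichotomy m n with h | rfl | h
  · exact ⟨_, G.mul_mem (G.inv_mem hf) hg, hm.exists_isBump hn (hfg x le_rfl) hx h⟩
  · refine absurd ?_ hxf
    obtain ⟨s, c, hs⟩ := not_not.1 hxg
    have heq : ∀ᶠ y in 𝓝 x, f.1 y = g.1 y := by
      rw [← nhdsLE_sup_nhdsGT, Filter.eventually_sup]
      refine ⟨by filter_upwards [self_mem_nhdsWithin] with y hy using hfg y hy, ?_⟩
      filter_upwards [hm, hn] with y h1 h2
      apply Subtype.ext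
      rw [h1, h2, hfg x le_rfl]
    exact ⟨s, c, by filter_upwards [heq, hs] with y h1 h2 using by rw [h1, h2]⟩
  · exact ⟨_, G.mul_mem (G.inv_mem hg) hf, hn.exists_isBump hm (hfg x le_rfl).symm hx h⟩

theorem exists_first_breakpoint (f : PLo) {t : I} (h : (breakpoints f.1 ∩ Set.Ioi t).Nonempty) :
    ∃ x, t < x ∧ x ∈ breakpoints f.1 ∧ ∀ y ∈ Set.Ioo t x, y ∉ breakpoints f.1 := by
  obtain ⟨x, hx, hmin⟩ := (f.2.2.inter_of_left (Set.Ioi t)).exists_minimal h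
  exact ⟨x, hx.2, hx.1, fun y hy hyb => hy.2.not_ge (hmin ⟨hyb, hy.1⟩ hy.2.le)⟩

/-- Given an element on `[0, t]` and its slope at `t`, all but at most one of the possible next
breakpoints are left ends of bumps, so there are only countably many. -/
theorem NoOverlap.countable_first_breakpoints (hG : NoOverlap G) {U : Set PLo} (hU : U ⊆ G)
    {t : I} {m : ℝ} (hUt : ∀ f ∈ U, ∀ g ∈ U, ∀ y ≤ t, f.1 y = g.1 y)
    (hm : ∀ f ∈ U, IsRightSlope f t m) :
    {x | t < x ∧ ∃ f ∈ U, x ∈ breakpoints f.1 ∧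
      ∀ y ∈ Set.Ioo t x, y ∉ breakpoints f.1}.Countable := by
  set X := {x | t < x ∧ ∃ f ∈ U, x ∈ breakpoints f.1 ∧ ∀ y ∈ Set.Ioo t x, y ∉ breakpoints f.1}
  set E : Set I := Prod.fst '' {p : I × I | ∃ f ∈ G, IsBump f p.1 p.2}
  have hE : E.Countable := hG.countable_bumps.image _
  have key : ∀ x ∈ X, ∀ x' ∈ X, x < x' → x ∈ E := by
    rintro x ⟨htx, f, hf, hxf, hfE⟩ x' ⟨-, g, hg, -, hgE⟩ hlt
    obtain ⟨h, hh, b, hb⟩ := exists_isBump_of_breakpoint (hU hf) (hU hg)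
      (hlt.trans_le x'.2.2) (fun y hy => (hm f hf).eqOn (hm g hg) (hUt f hf g hg) htx hfE
        (fun y hy => hgE y ⟨hy.1, hy.2.trans hlt⟩) hy) hxf (hgE x ⟨htx, hlt⟩)
    exact ⟨(x, b), ⟨h, hh, hb⟩, rfl⟩
  have hsub : (X \ E).Subsingleton := by
    rintro x ⟨hx, hxE⟩ x' ⟨hx', hxE'⟩
    rcases lt_trichotomy x x' with h | h | h
    · exact absurd (key x hx x' hx' h) hxE
    · exact h
    · exact absurd (key x' hx' x hx h) hxE'
  exact (hsub.countable.union hE).mono fun x hx => by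
    by_cases h : x ∈ E
    · exact Or.inr h
    · exact Or.inl ⟨hx, h⟩

/-- By induction on the number of breakpoints after `t`: an element given on `[0, t]` is determined
up to its next breakpoint `x` by its slope at `t` and by `x`, for which there are countably many
choices, and after `x` it has fewer breakpoints. -/
theorem NoOverlap.countable_of_eqOn (hG : NoOverlap G) (n : ℕ) :
    ∀ (t : I) (U : Set PLo), U ⊆ G → (∀ f ∈ U, ∀ g ∈ U, ∀ y ≤ t, f.1 y = g.1 y) →
      (∀ f ∈ U, (breakpoints f.1 ∩ Set.Ioi t).ncard < n) → U.Countable := by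
  induction n with
  | zero => exact fun t U _ _ hn =>
      Set.Subsingleton.countable fun f hf => absurd (hn f hf) (Nat.not_lt_zero _)
  | succ n ih =>
    intro t U hU hUt hn
    rcases eq_or_lt_of_le (show t ≤ 1 from t.2.2) with rfl | ht
    · exact Set.Subsingleton.countable fun f hf g hg =>
        Subtype.ext (Homeomorph.ext fun y => hUt f hf g hg y y.2.2)
    suffices hV : ∀ m, {f | f ∈ U ∧ IsRightSlope f t m}.Countable by
      refine ((hG.countable_rightSlopes hU ht fun f hf g hg => hUt f hf g hg t le_rfl).biUnion
        fun m _ => hV m).mono fun f hf => ?_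
      obtain ⟨m, hm⟩ := exists_isRightSlope f t
      exact Set.mem_iUnion₂.2 ⟨m, ⟨f, hf, hm⟩, hf, hm⟩
    intro m
    have hX := hG.countable_first_breakpoints (U := {f | f ∈ U ∧ IsRightSlope f t m})
      (fun f hf => hU hf.1) (fun f hf g hg => hUt f hf.1 g hg.1) fun f hf => hf.2
    have h0 : {f | (f ∈ U ∧ IsRightSlope f t m) ∧
        ∀ y ∈ Set.Ioo t 1, y ∉ breakpoints f.1}.Subsingleton := by
      rintro f ⟨⟨hf, hfm⟩, hfE⟩ g ⟨⟨hg, hgm⟩, hgE⟩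
      exact Subtype.ext (Homeomorph.ext fun y =>
        hfm.eqOn hgm (hUt f hf g hg) ht hfE hgE y.2.2)
    have h1 : ∀ x, t < x → {f | (f ∈ U ∧ IsRightSlope f t m) ∧ x ∈ breakpoints f.1 ∧
        ∀ y ∈ Set.Ioo t x, y ∉ breakpoints f.1}.Countable := by
      intro x htx
      refine ih x _ (fun f hf => hU hf.1.1) ?_ ?_
      · rintro f ⟨⟨hf, hfm⟩, -, hfE⟩ g ⟨⟨hg, hgm⟩, -, hgE⟩ y hy
        exact hfm.eqOn hgm (hUt f hf g hg) htx hfE hgE hy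
      · rintro f ⟨⟨hf, -⟩, hxf, -⟩
        have hss : breakpoints f.1 ∩ Set.Ioi x ⊂ breakpoints f.1 ∩ Set.Ioi t :=
          (Set.ssubset_iff_of_subset
            (Set.inter_subset_inter_right _ (Set.Ioi_subset_Ioi htx.le))).2
            ⟨x, ⟨hxf, htx⟩, fun h => lt_irrefl x h.2⟩
        exact (Set.ncard_lt_ncard hss (f.2.2.inter_of_left _)).trans_le
          (Nat.lt_succ_iff.1 (hn f hf))
    refine (h0.countable.union (hX.biUnion fun x hx => h1 x hx.1)).mono fun f hf => ?_
    rcases (breakpoints f.1 ∩ Set.Ioi t).eq_empty_or_nonempty with h | h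
    · exact Or.inl ⟨hf, fun y hy hyb => by
        have hmem : y ∈ breakpoints f.1 ∩ Set.Ioi t := ⟨hyb, hy.1⟩
        rwa [h] at hmem⟩
    · obtain ⟨x, htx, hx⟩ := exists_first_breakpoint f h
      exact Or.inr (Set.mem_iUnion₂.2 ⟨x, ⟨htx, f, hf, hx⟩, hf, hx⟩)

end PLHomeo

theorem mainTheorem3 (G : Subgroup PLHomeo.PLo) (hG : PLHomeo.NoTransitionChains G) :
    Countable G := by
  have hn : ∀ n : ℕ,
      {f | f ∈ G ∧ (PLHomeo.breakpoints f.1 ∩ Set.Ioi 0).ncard < n}.Countable := by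
    intro n
    refine hG.noOverlap.countable_of_eqOn n 0 _ (fun f hf => hf.1) ?_ fun f hf => hf.2
    intro f _ g _ y hy
    obtain rfl : y = 0 := le_antisymm hy y.2.1
    rw [PLHomeo.apply_zero, PLHomeo.apply_zero]
  have h : (G : Set PLHomeo.PLo).Countable := by
    refine (Set.countable_iUnion hn).mono fun f hf => ?_
    exact Set.mem_iUnion.2 ⟨_, hf, Nat.lt_succ_self _⟩
  exact h.to_subtype
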